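/- Let $m,s,t$ be positive integers. A nonconsecutive magic square set $NMSS(m,s;t)$ is a collection of $t$ arrays of size $m\times m$, some of whose cells may be empty, such that in each array every row and every column contains exactly $s$ filled cells, the entries of the $t$ arrays together are the numbers $0,1,\ldots,mst-1$, each appearing exactly once in the whole collection, and all row sums and all column sums of all $t$ arrays are equal to one and the same constant. For an integer $d$, the $d$-th diagonal of an $m\times m$ array with rows and columns indexed by $0,\ldots,m-1$ is the set of cells $(i,j)$ with $i\equiv j+d \pmod m$. Then an $NMSS(m,s;t)$ exists if and only if either $m=s=t=1$, or $3\le s\le m$ and ($s$ is even or $mt$ is odd). Moreover, whenever this condition holds, there is an $NMSS(m,s;t)$ such that, for each of its $t$ squares, all entries of that square lie on $s$ consecutive diagonals $d, d+1,\ldots,d+s-1$ (taken modulo $m$). -/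

import Mathlib

/-- An `m × m` array of natural numbers in which cells may be empty (`none`). -/
abbrev PartialSquare (m : ℕ) := Fin m → Fin m → Option ℕ

namespace PartialSquare

variable {m : ℕ}

/-- The sum of the entries in row `i` (empty cells contribute nothing). -/
def rowSum (A : PartialSquare m) (i : Fin m) : ℕ := ∑ j, (A i j).getD 0

/-- The sum of the entries in column `j` (empty cells contribute nothing). -/
def colSum (A : PartialSquare m) (j : Fin m) : ℕ := ∑ i, (A i j).getD 0

/-- A nonconsecutive magic square `NMS(m;s)`: exactly `s` filled cells in each row and in each
column, no number occurs twice, all row sums agree and all column sums agree. -/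
structure IsNMS (s : ℕ) (A : PartialSquare m) : Prop where
  row_filled : ∀ i, (Finset.univ.filter fun j => (A i j).isSome).card = s
  col_filled : ∀ j, (Finset.univ.filter fun i => (A i j).isSome).card = s
  distinct : ∀ i j i' j' k, A i j = some k → A i' j' = some k → i = i' ∧ j = j'
  row_sum : ∃ M, ∀ i, A.rowSum i = M
  col_sum : ∃ N, ∀ j, A.colSum j = N

/-- All entries of `A` lie on `s` consecutive diagonals, diagonal `d` being the set of cells
`(i, j)` with `i ≡ j + d` modulo `m`. -/
def OnConsecutiveDiagonals (s : ℕ) (A : PartialSquare m) : Prop :=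
  ∃ d : ℕ, ∀ i j, (A i j).isSome → ∃ r < s, (i : ℕ) ≡ (j : ℕ) + (d + r) [MOD m]

end PartialSquare

/-- A nonconsecutive magic square set `NMSS(m,s;t)`: `t` nonconsecutive magic squares `NMS(m;s)`
whose entries are `0, 1, …, mst - 1`, each appearing exactly once in the whole collection, with
all row sums and all column sums in all squares equal to one constant. -/
structure IsNMSS (m s t : ℕ) (T : Fin t → PartialSquare m) : Prop where
  isNMS : ∀ l, (T l).IsNMS s
  entry_lt : ∀ l i j k, T l i j = some k → k < m * s * t
  existsUnique_cell : ∀ k < m * s * t,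
    ∃! p : Fin t × Fin m × Fin m, T p.1 p.2.1 p.2.2 = some k
  sums_eq : ∃ C, ∀ l, (∀ i, (T l).rowSum i = C) ∧ (∀ j, (T l).colSum j = C)

/-! Sufficiency separates into a single-square problem and a problem about `t`. First, `s`
consecutive diagonals of one `m × m` array can be filled with `0, …, sm - 1` so that all lines have
equal sums (`exists_isDiagonalMagic`): explicit fillings for 3, 4, 5, 6 diagonals, then four more
diagonals at a time. Second, there are `s` permutations of `0, …, t - 1` with constant pointwise sum
(`exists_isBalanced`). Replacing each entry `n` on diagonal `r` by `t * n + β l r` in square `l`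
uses every number below `mst` once, and keeps line sums constant because each line meets each
diagonal exactly once.

Necessity is a double count: the common sum `C` satisfies `2 * C = s * (mst - 1)`, so odd `s` forces
`mt` odd. For `s = 1` every entry is `C`; for `s = 2` the number `C` accompanies `0` in both its row
and its column. -/

namespace DiagonalMagic

open scoped Fin.CommRing

/-! ### Fillings of consecutive diagonals -/

/-- `f r j` is the entry of column `j` on the `r`-th of `s` consecutive diagonals of an `m × m`
array; the entries are `0, …, sm - 1` and all row and column sums agree. -/
structure IsDiagonalMagic (m s : ℕ) [NeZero m] (f : ℕ → Fin m → ℤ) : Prop where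
  nonneg : ∀ r < s, ∀ j, 0 ≤ f r j
  lt : ∀ r < s, ∀ j, f r j < s * m
  inj : ∀ r < s, ∀ r' < s, ∀ j j', f r j = f r' j' → r = r' ∧ j = j'
  sums : ∃ C, (∀ j, ∑ r ∈ Finset.range s, f r j = C) ∧
    ∀ i, ∑ r ∈ Finset.range s, f r (i - (r : Fin m)) = C

/-- The column shift by `s` compensates for `g` starting at diagonal `s`: row `i` meets diagonal `s
+ r` in column `i - s - r`, which the shift sends to `i - r`. -/
theorem IsDiagonalMagic.append {m s s' : ℕ} [NeZero m] {f g : ℕ → Fin m → ℤ}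
    (hf : IsDiagonalMagic m s f) (hg : IsDiagonalMagic m s' g) :
    IsDiagonalMagic m (s + s') fun r j =>
      if r < s then f r j else s * m + g (r - s) (j + (s : Fin m)) where
  nonneg r hr j := by
    split_ifs with h
    · exact hf.nonneg r h j
    · have := hg.nonneg (r - s) (by omega) (j + (s : Fin m))
      positivity
  lt r hr j := by
    push_cast
    rw [add_mul]
    split_ifs with h
    · have := hf.lt r h j
      have : (0 : ℤ) ≤ s' * m := by positivity
      omega
    · have := hg.lt (r - s) (by omega) (j + (s : Fin m))
      omega
  inj r hr r' hr' j j' h := by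
    split_ifs at h with h1 h2 h2
    · exact hf.inj r h1 r' h2 j j' h
    · have := hf.lt r h1 j
      have := hg.nonneg (r' - s) (by omega) (j' + (s : Fin m))
      omega
    · have := hf.lt r' h2 j'
      have := hg.nonneg (r - s) (by omega) (j + (s : Fin m))
      omega
    · have := hg.inj (r - s) (by omega) (r' - s) (by omega) _ _ (add_left_cancel h)
      exact ⟨by omega, add_right_cancel this.2⟩
  sums := by
    obtain ⟨C, hc, hr⟩ := hf.sums
    obtain ⟨D, hd, hs⟩ := hg.sums
    refine ⟨C + (s' * (s * m) + D), fun j => ?_, fun i => ?_⟩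
    · rw [Finset.sum_range_add, ← hc j, ← hd (j + (s : Fin m))]
      congr 1
      · exact Finset.sum_congr rfl fun r hr => if_pos (Finset.mem_range.1 hr)
      · simp [Finset.sum_add_distrib]
    · rw [Finset.sum_range_add, ← hr i, ← hs i]
      congr 1
      · exact Finset.sum_congr rfl fun r hr => if_pos (Finset.mem_range.1 hr)
      · simp only [add_lt_iff_neg_left, not_lt_zero, if_false, Finset.sum_add_distrib,
          add_tsub_cancel_left]
        simp only [Finset.sum_const, Finset.card_range, nsmul_eq_mul, add_right_inj]
        refine Finset.sum_congr rfl fun r _ => congrArg _ ?_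
        push_cast
        ring

/-- Diagonals that are permutations of `0, …, m - 1` are made disjoint by adding `rm`. -/
theorem IsDiagonalMagic.of_blocks {m s : ℕ} [NeZero m] {g : ℕ → Fin m → ℤ}
    (nonneg : ∀ r < s, ∀ j, 0 ≤ g r j) (lt : ∀ r < s, ∀ j, g r j < m)
    (inj : ∀ r < s, Function.Injective (g r))
    (sums : ∃ C, (∀ j, ∑ r ∈ Finset.range s, g r j = C) ∧
      ∀ i, ∑ r ∈ Finset.range s, g r (i - (r : Fin m)) = C) :
    IsDiagonalMagic m s fun r j => r * m + g r j where
  nonneg r hr j := by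
    have := nonneg r hr j
    positivity
  lt r hr j := by
    have := lt r hr j
    have : ((r : ℤ) + 1) * m ≤ s * m := by gcongr; exact_mod_cast hr
    linarith
  inj r hr r' hr' j j' h := by
    have e : (r : ℤ) = r' := by
      have h1 := nonneg r hr j
      have h2 := lt r hr j
      have h3 := nonneg r' hr' j'
      have h4 := lt r' hr' j'
      have hm : (0 : ℤ) < m := by linarith
      rcases lt_trichotomy (r : ℤ) r' with h5 | h5 | h5
      · nlinarith
      · exact h5
      · nlinarith
    have e' : r = r' := by exact_mod_cast e
    subst e'
    exact ⟨rfl, inj r hr (add_left_cancel h)⟩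
  sums := by
    obtain ⟨C, hc, hr⟩ := sums
    refine ⟨∑ r ∈ Finset.range s, (r : ℤ) * m + C, fun j => ?_, fun i => ?_⟩
    · rw [Finset.sum_add_distrib, hc]
    · rw [Finset.sum_add_distrib, hr]

/-! ### Four and six diagonals, any order -/

/-- Complementary pairs are diagonals 0, 1 and 2, 3 within a column; the shift by 2 makes them 0, 2
and 1, 3 within a row. -/
theorem exists_isDiagonalMagic_four (m : ℕ) [NeZero m] : ∃ f, IsDiagonalMagic m 4 f := by
  let g : ℕ → Fin m → ℤ
    | 0, j => j.val
    | 1, j => m - 1 - j.val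
    | 2, j => m - 1 - (j + 2).val
    | _, j => (j + 2).val
  have key : ∀ j : Fin m, (0 : ℤ) ≤ j.val ∧ (j.val : ℤ) < m := fun j => ⟨by positivity, by simp⟩
  have inj : ∀ j j' : Fin m, (j.val : ℤ) = j'.val → j = j' := fun j j' h => by
    ext; exact_mod_cast h
  refine ⟨_, IsDiagonalMagic.of_blocks (g := g) ?_ ?_ ?_ ⟨2 * (m - 1), ?_, ?_⟩⟩
  · intro r hr j
    have := key j
    have := key (j + 2)
    interval_cases r <;> simp only [g] <;> omega
  · intro r hr j
    have := key j
    have := key (j + 2)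
    interval_cases r <;> simp only [g] <;> omega
  · intro r hr j j' h
    interval_cases r <;> simp only [g] at h
    · exact inj _ _ h
    · exact inj _ _ (by omega)
    · exact add_right_cancel (inj _ _ (by omega : ((j + 2).val : ℤ) = (j' + 2).val))
    · exact add_right_cancel (inj _ _ h)
  · intro j
    simp only [Finset.sum_range_succ, Finset.sum_range_zero, g]
    ring
  · intro i
    simp only [Finset.sum_range_succ, Finset.sum_range_zero, g]
    push_cast
    rw [show i - 2 + 2 = i by ring, show i - 3 + 2 = i - 1 by ring, sub_zero]
    ring

/-- Each column consists of three pairs with sum `6 * m - 1`. In a row, columns `i` and `i - 1`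
contribute with coefficients `-2, 1, 1` and `2, -1, -1`, which cancel. The slopes `∓2` come from
diagonals 0 and 1 sharing `2m, …, 4m - 1`, evens on one and odds on the other. -/
theorem exists_isDiagonalMagic_six (m : ℕ) [NeZero m] : ∃ f, IsDiagonalMagic m 6 f := by
  let f : ℕ → Fin m → ℤ
    | 0, j => 4 * m - 2 - 2 * j.val
    | 1, j => 2 * m + 1 + 2 * j.val
    | 2, j => 5 * m + (j + 2).val
    | 3, j => m - 1 - (j + 2).val
    | 4, j => m + (j + 4).val
    | _, j => 5 * m - 1 - (j + 4).val
  have key : ∀ j : Fin m, (0 : ℤ) ≤ j.val ∧ (j.val : ℤ) < m := fun j => ⟨by positivity, by simp⟩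
  have inj : ∀ j j' : Fin m, (j.val : ℤ) = j'.val → j = j' := fun j j' h => by
    ext; exact_mod_cast h
  refine ⟨f, ?_, ?_, ?_, 3 * (6 * m - 1), ?_, ?_⟩
  · intro r hr j
    have := key j
    have := key (j + 2)
    have := key (j + 4)
    interval_cases r <;> simp only [f] <;> omega
  · intro r hr j
    have := key j
    have := key (j + 2)
    have := key (j + 4)
    interval_cases r <;> simp only [f] <;> push_cast <;> omega
  · intro r hr r' hr' j j' h
    have := key j
    have := key (j + 2)
    have := key (j + 4)
    have := key j'
    have := key (j' + 2)
    have := key (j' + 4)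
    have inj2 : ((j + 2).val : ℤ) = (j' + 2).val → j = j' := fun h => add_right_cancel (inj _ _ h)
    have inj4 : ((j + 4).val : ℤ) = (j' + 4).val → j = j' := fun h => add_right_cancel (inj _ _ h)
    interval_cases r <;> interval_cases r' <;> simp only [f] at h <;>
      first
      | exact ⟨rfl, inj _ _ (by omega)⟩
      | exact ⟨rfl, inj2 (by omega)⟩
      | exact ⟨rfl, inj4 (by omega)⟩
      | omega
  · intro j
    simp only [Finset.sum_range_succ, Finset.sum_range_zero, f]
    ring
  · intro i
    simp only [Finset.sum_range_succ, Finset.sum_range_zero, f]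
    push_cast
    rw [show i - 2 + 2 = i by ring, show i - 3 + 2 = i - 1 by ring, show i - 4 + 4 = i by ring,
      show i - 5 + 4 = i - 1 by ring, sub_zero]
    ring

/-! ### Three and five diagonals, odd order -/

theorem cast_val_injective {m : ℕ} {j j' : Fin m} (h : (j.val : ℤ) = j'.val) : j = j' := by
  ext; exact_mod_cast h

theorem val_sub_one {m : ℕ} [NeZero m] (j : Fin m) :
    (j - 1).val = if j.val = 0 then m - 1 else j.val - 1 := by
  obtain ⟨n, rfl⟩ := Nat.exists_eq_succ_of_ne_zero (NeZero.ne m)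
  rw [Fin.coe_sub_one]
  exact if_congr Fin.ext_iff rfl rfl

/-- Consecutive terms of this arrangement `0, M + 1, 1, M + 2, …, M` of `0, …, 2M` have sums
`M, …, 3M` in some order. -/
def zigzag (M v : ℕ) : ℤ := if v % 2 = 0 then v / 2 else M + (v + 1) / 2

/-- The middle diagonal completes `z j + z (j - 1)` to `3 * M`; in row `i` it faces the same two
values, `z (i - 1)` and `z (i - 2)`. It is a permutation by the property of `zigzag`, including the
wrap-around sum `M`. -/
theorem exists_isDiagonalMagic_three (m : ℕ) [NeZero m] (hm : Odd m) :
    ∃ f, IsDiagonalMagic m 3 f := by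
  obtain ⟨M, hM⟩ := hm
  let z : Fin m → ℤ := fun j => zigzag M j.val
  have z_def (j : Fin m) :
      z j = if j.val % 2 = 0 then (j.val : ℤ) / 2 else M + (j.val + 1) / 2 := rfl
  have z_pred (j : Fin m) : z (j - 1) =
      if j.val = 0 then (M : ℤ) else
        if j.val % 2 = 0 then M + (j.val : ℤ) / 2 else ((j.val : ℤ) - 1) / 2 := by
    rw [z_def, val_sub_one]
    split_ifs <;> omega
  have z_inj : Function.Injective z := fun j j' h => cast_val_injective <| by
    have := j.isLt
    have := j'.isLt
    rw [z_def, z_def] at h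
    split_ifs at h <;> omega
  let g : ℕ → Fin m → ℤ
    | 0, j => z (j - 1)
    | 1, j => 3 * M - z j - z (j - 1)
    | _, j => z j
  have bound (r : ℕ) (hr : r < 3) (j : Fin m) : 0 ≤ g r j ∧ g r j < m := by
    have := j.isLt
    interval_cases r <;> simp only [g, z_pred, z_def] <;> split_ifs <;> omega
  refine ⟨_, IsDiagonalMagic.of_blocks (g := g) (fun r hr j => (bound r hr j).1)
    (fun r hr j => (bound r hr j).2) ?_ ⟨3 * M, ?_, ?_⟩⟩
  · intro r hr j j' h
    interval_cases r <;> simp only [g] at h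
    · exact sub_left_injective (z_inj h)
    · refine cast_val_injective ?_
      have := j.isLt
      have := j'.isLt
      rw [z_pred, z_pred, z_def, z_def] at h
      split_ifs at h <;> omega
    · exact z_inj h
  · intro j
    simp only [Finset.sum_range_succ, Finset.sum_range_zero, g]
    ring
  · intro i
    simp only [Finset.sum_range_succ, Finset.sum_range_zero, g]
    push_cast
    rw [show i - 1 - 1 = i - 2 by ring, sub_zero]
    ring

/-- Together with `fiveRight`: arrangements of `0, …, 2M` whose sums `fiveLeft v + fiveRight v`
and whose differences `fiveLeft (v + 1) - fiveRight v` (cyclically) are consecutive integers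
in some order. -/
def fiveLeft (M v : ℕ) : ℤ :=
  if v = 0 then 0 else
  if v = 2 * M then 1 else
  if v < 2 * (M / 2) then (if v % 2 = 0 then v / 2 + 1 else 2 * M - v / 2)
  else (if v % 2 = 0 then 2 * M - v / 2 else v / 2 + 1)

def fiveRight (M v : ℕ) : ℤ :=
  if v = 0 then 2 * M else
  if v = 2 * M then M else
  if v + 1 = 2 * M then 0 else
  if v = 2 * (M / 2) then M + M / 2 else
  if v < 2 * (M / 2) then (if v % 2 = 0 then M + v / 2 else M - v / 2 - 1)
  else (if v % 2 = 0 then M - v / 2 else M + v / 2 + 1)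

/-- The sums `fiveLeft v + fiveRight v`. -/
def fiveSum (M v : ℕ) : ℤ :=
  if v = 0 then 2 * M else
  if v = 2 * M then M + 1 else
  if v + 1 = 2 * M then M else
  if v = 2 * (M / 2) then 3 * M else
  if v < 2 * (M / 2) then (if v % 2 = 0 then M + 2 * (v / 2) + 1 else 3 * M - 2 * (v / 2) - 1)
  else (if v % 2 = 0 then 3 * M - 2 * (v / 2) else M + 2 * (v / 2) + 2)

/-- The differences `fiveLeft (v + 1) - fiveRight v`, shifted to `0, …, 2M`. -/
def fiveDiff (M v : ℕ) : ℤ :=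
  if v = 0 then 0 else
  if v = 1 then M else
  if v = 2 * M then M + 1 else
  if v = 2 * (M / 2) then 2 * M else
  if v = 2 * (M / 2) + 1 then 1 else
  if v < 2 * (M / 2) then (if v % 2 = 0 then 2 * (v / 2) + 1 else 2 * M - 2 * (v / 2))
  else (if v % 2 = 0 then 2 * M - 2 * (v / 2) else 2 * (v / 2) + 1)

theorem fiveLeft_injOn {M v w : ℕ} (hM : 2 ≤ M) (hv : v < 2 * M + 1) (hw : w < 2 * M + 1)
    (h : fiveLeft M v = fiveLeft M w) : v = w := by
  unfold fiveLeft at h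
  split_ifs at h <;> omega

set_option maxHeartbeats 1000000 in
theorem fiveRight_injOn {M v w : ℕ} (hM : 2 ≤ M) (hv : v < 2 * M + 1) (hw : w < 2 * M + 1)
    (h : fiveRight M v = fiveRight M w) : v = w := by
  unfold fiveRight at h
  split_ifs at h <;> omega

set_option maxHeartbeats 1000000 in
theorem fiveDiff_injOn {M v w : ℕ} (hM : 2 ≤ M) (hv : v < 2 * M + 1) (hw : w < 2 * M + 1)
    (h : fiveDiff M v = fiveDiff M w) : v = w := by
  unfold fiveDiff at h
  split_ifs at h <;> omega

set_option maxHeartbeats 1000000 in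
theorem fiveSum_injOn {M v w : ℕ} (hM : 2 ≤ M) (hv : v < 2 * M + 1) (hw : w < 2 * M + 1)
    (h : fiveSum M v = fiveSum M w) : v = w := by
  unfold fiveSum at h
  split_ifs at h <;> omega

set_option maxHeartbeats 1000000 in
theorem fiveLeft_add_fiveRight {M v : ℕ} (hM : 2 ≤ M) (hv : v < 2 * M + 1) :
    fiveLeft M v + fiveRight M v = fiveSum M v := by
  unfold fiveLeft fiveRight fiveSum
  split_ifs <;> omega

-- The `if` is the cyclic predecessor of `v` in the form given by `val_sub_one`; `fiveDiff M v` thus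
-- belongs to the step from `v - 1` to `v`.
set_option maxHeartbeats 1000000 in
theorem fiveLeft_sub_fiveRight {M v : ℕ} (hM : 2 ≤ M) (hv : v < 2 * M + 1) :
    fiveLeft M v - fiveRight M (if v = 0 then 2 * M + 1 - 1 else v - 1) = fiveDiff M v - M := by
  unfold fiveLeft fiveRight fiveDiff
  split_ifs <;> omega

theorem fiveLeft_mem {M v : ℕ} (hM : 2 ≤ M) (hv : v < 2 * M + 1) :
    0 ≤ fiveLeft M v ∧ fiveLeft M v < 2 * M + 1 := by
  unfold fiveLeft
  split_ifs <;> omega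

theorem fiveRight_mem {M v : ℕ} (hM : 2 ≤ M) (hv : v < 2 * M + 1) :
    0 ≤ fiveRight M v ∧ fiveRight M v < 2 * M + 1 := by
  unfold fiveRight
  split_ifs <;> omega

theorem fiveSum_mem {M v : ℕ} (hM : 2 ≤ M) (hv : v < 2 * M + 1) :
    M ≤ fiveSum M v ∧ fiveSum M v < 3 * M + 1 := by
  unfold fiveSum
  split_ifs <;> omega

theorem fiveDiff_mem {M v : ℕ} (hM : 2 ≤ M) (hv : v < 2 * M + 1) :
    0 ≤ fiveDiff M v ∧ fiveDiff M v < 2 * M + 1 := by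
  unfold fiveDiff
  split_ifs <;> omega

/-- Diagonals 0, 1, 2 sum to `3 * M` in each column but leave `a i - a (i - 1) - c (i - 1) + c (i -
2)` in row `i`. This equals `d i - d (i - 1)`, which the complementary pair on diagonals 3, 4
cancels. -/
theorem exists_isDiagonalMagic_five (m : ℕ) [NeZero m] (hm : Odd m) (h5 : 5 ≤ m) :
    ∃ f, IsDiagonalMagic m 5 f := by
  obtain ⟨M, hM⟩ := hm
  have hM2 : 2 ≤ M := by omega
  have lt (j : Fin m) : j.val < 2 * M + 1 := hM ▸ j.isLt
  let a : Fin m → ℤ := fun j => fiveLeft M j.val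
  let c : Fin m → ℤ := fun j => fiveRight M j.val
  let b : Fin m → ℤ := fun j => fiveSum M j.val
  let d : Fin m → ℤ := fun j => fiveDiff M j.val
  have hb (j : Fin m) : b j = a j + c j := (fiveLeft_add_fiveRight hM2 (lt j)).symm
  have hd (j : Fin m) : d j = a j - c (j - 1) + M := by
    have := fiveLeft_sub_fiveRight hM2 (lt j)
    rw [← hM, ← val_sub_one] at this
    simp only [a, c, d]
    linarith
  let g : ℕ → Fin m → ℤ
    | 0, j => a j
    | 1, j => 3 * M - b j
    | 2, j => c j
    | 3, j => 2 * M - d (j + 3)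
    | _, j => d (j + 3)
  have bound (r : ℕ) (hr : r < 5) (j : Fin m) : 0 ≤ g r j ∧ g r j < m := by
    have ha := fiveLeft_mem hM2 (lt j)
    have hb := fiveSum_mem hM2 (lt j)
    have hc := fiveRight_mem hM2 (lt j)
    have hd := fiveDiff_mem hM2 (lt (j + 3))
    interval_cases r <;> simp only [g, a, b, c, d] <;> omega
  refine ⟨_, IsDiagonalMagic.of_blocks (g := g) (fun r hr j => (bound r hr j).1)
    (fun r hr j => (bound r hr j).2) ?_ ⟨5 * M, ?_, ?_⟩⟩
  · intro r hr j j' h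
    have hj := lt j
    have hj' := lt j'
    interval_cases r <;> simp only [g] at h
    · exact Fin.ext (fiveLeft_injOn hM2 hj hj' h)
    · exact Fin.ext (fiveSum_injOn hM2 hj hj' (sub_right_injective h))
    · exact Fin.ext (fiveRight_injOn hM2 hj hj' h)
    · exact add_right_cancel (Fin.ext (fiveDiff_injOn hM2 (lt _) (lt _) (sub_right_injective h)))
    · exact add_right_cancel (Fin.ext (fiveDiff_injOn hM2 (lt _) (lt _) h))
  · intro j
    simp only [Finset.sum_range_succ, Finset.sum_range_zero, g, hb]
    ring
  · intro i
    simp only [Finset.sum_range_succ, Finset.sum_range_zero, g, hb]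
    push_cast
    rw [show i - 3 + 3 = i by ring, show i - 4 + 3 = i - 1 by ring, sub_zero, hd, hd,
      show i - 1 - 1 = i - 2 by ring]
    ring

theorem exists_isDiagonalMagic (m : ℕ) [NeZero m] (s : ℕ) (hs : 3 ≤ s) (hm : s ≤ m)
    (h : Even s ∨ Odd m) : ∃ f, IsDiagonalMagic m s f := by
  induction s using Nat.strong_induction_on with
  | _ s ih =>
    rcases lt_or_ge s 7 with h7 | h7
    · interval_cases s
      · exact exists_isDiagonalMagic_three m (h.resolve_left (by decide))
      · exact exists_isDiagonalMagic_four m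
      · exact exists_isDiagonalMagic_five m (h.resolve_left (by decide)) hm
      · exact exists_isDiagonalMagic_six m
    · obtain ⟨k, rfl⟩ := Nat.exists_eq_add_of_le' (show 4 ≤ s by omega)
      obtain ⟨f, hf⟩ := ih k (by omega) (by omega) (by omega) <|
        h.imp_left fun h => by simpa [Nat.even_add, show Even 4 by decide] using h
      obtain ⟨g, hg⟩ := exists_isDiagonalMagic_four m
      exact ⟨_, hf.append hg⟩

/-! ### Balanced families of permutations -/

/-- `s` permutations `β · r` of `0, …, t - 1` whose sum is constant. -/
structure IsBalanced (t s : ℕ) (β : ℕ → ℕ → ℤ) : Prop where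
  nonneg : ∀ l < t, ∀ r < s, 0 ≤ β l r
  lt : ∀ l < t, ∀ r < s, β l r < t
  inj : ∀ l < t, ∀ l' < t, ∀ r < s, β l r = β l' r → l = l'
  sum : ∃ C, ∀ l < t, ∑ r ∈ Finset.range s, β l r = C

theorem IsBalanced.add_two {t s : ℕ} {β : ℕ → ℕ → ℤ} (h : IsBalanced t s β) :
    IsBalanced t (s + 2) fun l r => if r < s then β l r else if r = s then l else t - 1 - l where
  nonneg l hl r hr := by
    split_ifs with h1
    · exact h.nonneg l hl r h1
    all_goals omega
  lt l hl r hr := by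
    split_ifs with h1
    · exact h.lt l hl r h1
    all_goals omega
  inj l hl l' hl' r hr e := by
    split_ifs at e with h1
    · exact h.inj l hl l' hl' r h1 e
    all_goals omega
  sum := by
    obtain ⟨C, hC⟩ := h.sum
    refine ⟨C + (t - 1), fun l hl => ?_⟩
    rw [Finset.sum_range_succ, Finset.sum_range_succ, ← hC l hl,
      Finset.sum_congr rfl fun r hr => if_pos (Finset.mem_range.1 hr)]
    simp

/-- Modulo `2 * M + 1` the three permutations are `l`, `l + M` and `-2 * l - 1`, up to the choice of
representatives that makes the sum exactly `3 * M`. -/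
theorem isBalanced_three (M : ℕ) : IsBalanced (2 * M + 1) 3 fun l r =>
    if r = 0 then l else if r = 1 then (if l ≤ M then M + l else l - M - 1)
    else (if l ≤ M then 2 * M - 2 * l else 4 * M + 1 - 2 * l) where
  nonneg l hl r hr := by interval_cases r <;> simp <;> split_ifs <;> omega
  lt l hl r hr := by interval_cases r <;> simp <;> (try split_ifs) <;> omega
  inj l hl l' hl' r hr e := by
    interval_cases r <;> simp at e <;> (try split_ifs at e) <;> omega
  sum := by
    refine ⟨3 * M, fun l hl => ?_⟩
    simp [Finset.sum_range_succ]
    split_ifs <;> ring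

theorem exists_isBalanced (t s : ℕ) (hs : 3 ≤ s) (h : Even s ∨ Odd t) :
    ∃ β, IsBalanced t s β := by
  induction s using Nat.strong_induction_on with
  | _ s ih =>
    rcases lt_or_ge s 5 with h5 | h5
    · interval_cases s
      · obtain ⟨M, rfl⟩ := h.resolve_left (by decide)
        exact ⟨_, isBalanced_three M⟩
      · have h0 : IsBalanced t 0 fun _ _ => 0 :=
          ⟨by simp, by simp, by simp, 0, by simp⟩
        exact ⟨_, h0.add_two.add_two⟩
    · obtain ⟨k, rfl⟩ := Nat.exists_eq_add_of_le' (show 2 ≤ s by omega)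
      obtain ⟨β, hβ⟩ := ih k (by omega) (by omega) <|
        h.imp_left fun h => by simpa [Nat.even_add] using h
      exact ⟨_, hβ.add_two⟩

/-! ### From diagonals to arrays -/

theorem sum_fin_ite_val_lt {m s : ℕ} (hs : s ≤ m) (F : ℕ → ℕ) :
    ∑ r : Fin m, (if r.val < s then F r.val else 0) = ∑ r ∈ Finset.range s, F r := by
  rw [Fin.sum_univ_eq_sum_range (fun r => if r < s then F r else 0), ← Finset.sum_filter]
  congr 1
  ext r
  simp only [Finset.mem_filter, Finset.mem_range]
  omega

/-- The array with entry `F r j` in column `j` of the `r`-th diagonal, for `r < s`. -/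
def diagonalArray {m : ℕ} [NeZero m] (s : ℕ) (F : ℕ → Fin m → ℕ) : PartialSquare m :=
  fun i j => if (i - j).val < s then some (F (i - j).val j) else none

section

variable {m : ℕ} [NeZero m] {s : ℕ} (hs : s ≤ m) (F : ℕ → Fin m → ℕ)

theorem diagonalArray_eq_some {i j : Fin m} {k : ℕ} :
    diagonalArray s F i j = some k ↔ (i - j).val < s ∧ F (i - j).val j = k := by
  simp [diagonalArray]

theorem diagonalArray_isSome {i j : Fin m} :
    (diagonalArray s F i j).isSome ↔ (i - j).val < s := by
  unfold diagonalArray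
  split_ifs with h <;> simp [h]

theorem diagonalArray_getD {i j : Fin m} :
    (diagonalArray s F i j).getD 0 = if (i - j).val < s then F (i - j).val j else 0 := by
  unfold diagonalArray
  split_ifs with h <;> simp

include hs

theorem sum_row_diagonals (i : Fin m) :
    ∑ j, (if (i - j).val < s then F (i - j).val j else 0) =
      ∑ r ∈ Finset.range s, F r (i - (r : Fin m)) := by
  rw [← sum_fin_ite_val_lt hs fun r => F r (i - (r : Fin m)), ← (Equiv.subLeft i).sum_comp]
  refine Finset.sum_congr rfl fun j _ => ?_
  simp

theorem sum_column_diagonals (j : Fin m) :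
    ∑ i : Fin m, (if (i - j).val < s then F (i - j).val j else 0) =
      ∑ r ∈ Finset.range s, F r j := by
  rw [← sum_fin_ite_val_lt hs fun r => F r j]
  exact (Equiv.subRight j).sum_comp fun r : Fin m => if r.val < s then F r.val j else 0

theorem rowSum_diagonalArray (i : Fin m) :
    (diagonalArray s F).rowSum i = ∑ r ∈ Finset.range s, F r (i - (r : Fin m)) := by
  simp only [PartialSquare.rowSum, diagonalArray_getD, sum_row_diagonals hs]

theorem colSum_diagonalArray (j : Fin m) :
    (diagonalArray s F).colSum j = ∑ r ∈ Finset.range s, F r j := by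
  simp only [PartialSquare.colSum, diagonalArray_getD, sum_column_diagonals hs]

theorem card_row_diagonalArray (i : Fin m) :
    (Finset.univ.filter fun j => (diagonalArray s F i j).isSome).card = s := by
  have := sum_row_diagonals hs (fun _ _ => 1) i
  simp only [diagonalArray_isSome, Finset.card_filter]
  simpa using this

theorem card_column_diagonalArray (j : Fin m) :
    (Finset.univ.filter fun i => (diagonalArray s F i j).isSome).card = s := by
  have := sum_column_diagonals hs (fun _ _ => 1) j
  simp only [diagonalArray_isSome, Finset.card_filter]
  simpa using this

end

theorem onConsecutiveDiagonals_diagonalArray {m : ℕ} [NeZero m] (s : ℕ) (F : ℕ → Fin m → ℕ) :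
    (diagonalArray s F).OnConsecutiveDiagonals s := by
  refine ⟨0, fun i j h => ⟨(i - j).val, (diagonalArray_isSome F).1 h, ?_⟩⟩
  have : i = j + (i - j) := by ring
  rw [zero_add, Nat.ModEq, ← Fin.val_add, ← this, Nat.mod_eq_of_lt i.isLt]

theorem isNMSS_diagonalArray {m s t : ℕ} [NeZero m] (hs : s ≤ m) (F : ℕ → ℕ → Fin m → ℕ)
    (lt : ∀ l < t, ∀ r < s, ∀ j, F l r j < m * s * t)
    (inj : ∀ l < t, ∀ l' < t, ∀ r < s, ∀ r' < s, ∀ j j', F l r j = F l' r' j' →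
      l = l' ∧ r = r' ∧ j = j')
    (C : ℕ) (col : ∀ l < t, ∀ j, ∑ r ∈ Finset.range s, F l r j = C)
    (row : ∀ l < t, ∀ i, ∑ r ∈ Finset.range s, F l r (i - (r : Fin m)) = C) :
    IsNMSS m s t fun l => diagonalArray s (F l) := by
  have cell_inj : ∀ (l l' : Fin t) (i j i' j' : Fin m) (k : ℕ),
      diagonalArray s (F l) i j = some k → diagonalArray s (F l') i' j' = some k →
      l = l' ∧ i = i' ∧ j = j' := by
    intro l l' i j i' j' k h h'
    rw [diagonalArray_eq_some] at h h'
    obtain ⟨e1, e2, rfl⟩ :=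
      inj l l.isLt l' l'.isLt _ h.1 _ h'.1 j j' (h.2.trans h'.2.symm)
    exact ⟨Fin.ext e1, sub_left_injective (Fin.ext e2), rfl⟩
  have row' (l : Fin t) (i : Fin m) : (diagonalArray s (F l)).rowSum i = C := by
    rw [rowSum_diagonalArray hs, row l l.isLt]
  have col' (l : Fin t) (j : Fin m) : (diagonalArray s (F l)).colSum j = C := by
    rw [colSum_diagonalArray hs, col l l.isLt]
  refine ⟨fun l => ⟨card_row_diagonalArray hs _, card_column_diagonalArray hs _,
    fun i j i' j' k h h' => (cell_inj l l i j i' j' k h h').2, ⟨C, row' l⟩, ⟨C, col' l⟩⟩,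
    fun l i j k h => ?_, fun k hk => ?_, ⟨C, fun l => ⟨row' l, col' l⟩⟩⟩
  · rw [diagonalArray_eq_some] at h
    exact h.2 ▸ lt l l.isLt _ h.1 j
  -- Every number occurs because an injection between sets of equal size `mst` is onto.
  · let φ : Fin t × Fin s × Fin m → Fin (m * s * t) := fun p =>
      ⟨F p.1 p.2.1 p.2.2, lt _ p.1.isLt _ p.2.1.isLt _⟩
    have φ_inj : Function.Injective φ := by
      rintro ⟨l, r, j⟩ ⟨l', r', j'⟩ h
      obtain ⟨e1, e2, rfl⟩ :=
        inj l l.isLt l' l'.isLt r r.isLt r' r'.isLt j j' (congrArg Fin.val h)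
      obtain rfl := Fin.ext e1
      obtain rfl := Fin.ext e2
      rfl
    obtain ⟨⟨l, r, j⟩, h⟩ := (φ_inj.bijective_of_nat_card_le (by
      simp only [Nat.card_eq_fintype_card, Fintype.card_prod, Fintype.card_fin]
      exact le_of_eq (by ring))).surjective ⟨k, hk⟩
    have h : F l r j = k := congrArg Fin.val h
    have hr : (j + (r.val : Fin m) - j).val = r.val := by
      rw [add_sub_cancel_left, Fin.val_natCast, Nat.mod_eq_of_lt (r.isLt.trans_le hs)]
    have hcell : diagonalArray s (F l) (j + (r.val : Fin m)) j = some k := by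
      rw [diagonalArray_eq_some, hr]
      exact ⟨r.isLt, h⟩
    refine ⟨(l, j + (r.val : Fin m), j), hcell, ?_⟩
    rintro ⟨l', i', j'⟩ h'
    obtain ⟨e1, e2, e3⟩ := cell_inj _ _ _ _ _ _ _ h' hcell
    exact Prod.ext e1 (Prod.ext e2 e3)

theorem exists_isNMSS {m s t : ℕ} (hs : 3 ≤ s) (hm : s ≤ m) (h : Even s ∨ Odd (m * t)) :
    ∃ T : Fin t → PartialSquare m, IsNMSS m s t T ∧ ∀ l, (T l).OnConsecutiveDiagonals s := by
  have : NeZero m := ⟨by omega⟩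
  obtain ⟨f, hf⟩ := exists_isDiagonalMagic m s hs hm (h.imp_right fun h => (Nat.odd_mul.1 h).1)
  obtain ⟨β, hβ⟩ := exists_isBalanced t s hs (h.imp_right fun h => (Nat.odd_mul.1 h).2)
  obtain ⟨C, hC, hC'⟩ := hf.sums
  obtain ⟨D, hD⟩ := hβ.sum
  let F : ℕ → ℕ → Fin m → ℕ := fun l r j => (t * f r j + β l r).toNat
  have cast_F : ∀ l < t, ∀ r < s, ∀ j, (F l r j : ℤ) = t * f r j + β l r := by
    intro l hl r hr j
    have := hf.nonneg r hr j
    have := hβ.nonneg l hl r hr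
    exact Int.toNat_of_nonneg (by positivity)
  have sum_F (l : ℕ) (hl : l < t) (x : ℕ → Fin m)
      (hx : ∑ r ∈ Finset.range s, f r (x r) = C) :
      ∑ r ∈ Finset.range s, F l r (x r) = (t * C + D).toNat := by
    rw [← Int.toNat_natCast (∑ r ∈ Finset.range s, F l r (x r)), ← hx, ← hD l hl, Finset.mul_sum,
      ← Finset.sum_add_distrib]
    push_cast
    exact congrArg _ (Finset.sum_congr rfl fun r hr => cast_F l hl r (Finset.mem_range.1 hr) _)
  refine ⟨_, isNMSS_diagonalArray hm F ?_ ?_ (t * C + D).toNat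
    (fun l hl j => sum_F l hl _ (hC j)) (fun l hl i => sum_F l hl _ (hC' i)),
    fun l => onConsecutiveDiagonals_diagonalArray s _⟩
  · intro l hl r hr j
    zify
    rw [cast_F l hl r hr]
    have h1 := hf.lt r hr j
    have h2 := hβ.lt l hl r hr
    nlinarith
  · intro l hl l' hl' r hr r' hr' j j' e
    have e : (F l r j : ℤ) = F l' r' j' := congrArg _ e
    rw [cast_F l hl r hr, cast_F l' hl' r' hr'] at e
    have h1 := hβ.lt l hl r hr
    have h2 := hβ.lt l' hl' r' hr'
    have h3 := hβ.nonneg l hl r hr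
    have h4 := hβ.nonneg l' hl' r' hr'
    -- As `β` takes values in `0, …, t - 1`, equality of `t * f + β` forces equal quotients, then
    -- equal remainders.
    have e' : f r j = f r' j' := by
      rcases lt_trichotomy (f r j) (f r' j') with h5 | h5 | h5
      · nlinarith
      · exact h5
      · nlinarith
    obtain ⟨rfl, rfl⟩ := hf.inj r hr r' hr' j j' e'
    exact ⟨hβ.inj l hl l' hl' r hr (add_left_cancel e), rfl, rfl⟩

theorem exists_isNMSS_one :
    ∃ T : Fin 1 → PartialSquare 1, IsNMSS 1 1 1 T ∧ ∀ l, (T l).OnConsecutiveDiagonals 1 :=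
  ⟨_, isNMSS_diagonalArray le_rfl (fun _ _ _ => 0) (by simp)
    (fun _ _ _ _ _ _ _ _ _ _ _ => by omega) 0 (by simp) (by simp),
    fun _ => onConsecutiveDiagonals_diagonalArray 1 _⟩

end DiagonalMagic

/-! ### Necessity -/

namespace IsNMSS

variable {m s t : ℕ} {T : Fin t → PartialSquare m}

theorem le (h : IsNMSS m s t T) (hm : 0 < m) (ht : 0 < t) : s ≤ m := by
  rw [← (h.isNMS ⟨0, ht⟩).row_filled ⟨0, hm⟩]
  exact (Finset.card_le_univ _).trans_eq (Fintype.card_fin m)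

theorem cell_unique (h : IsNMSS m s t T) {l l' : Fin t} {i j i' j' : Fin m} {k : ℕ}
    (e : T l i j = some k) (e' : T l' i' j' = some k) : l = l' ∧ i = i' ∧ j = j' := by
  have := (h.existsUnique_cell k (h.entry_lt l i j k e)).unique (y₁ := (l, i, j))
    (y₂ := (l', i', j')) e e'
  simpa using this

theorem two_mul_sum_eq {C : ℕ} (h : IsNMSS m s t T) (hm : 0 < m) (ht : 0 < t)
    (hC : ∀ l i, (T l).rowSum i = C) : 2 * C = s * (m * s * t - 1) := by
  have total : ∑ p : Fin t × Fin m × Fin m, (T p.1 p.2.1 p.2.2).getD 0 =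
      ∑ k ∈ Finset.range (m * s * t), k := by
    -- Writing an entry as a sum over its possible values allows the total to be summed by number
    -- instead of by cell.
    have split (p : Fin t × Fin m × Fin m) : (T p.1 p.2.1 p.2.2).getD 0 =
        ∑ k ∈ Finset.range (m * s * t), if T p.1 p.2.1 p.2.2 = some k then k else 0 := by
      rcases e : T p.1 p.2.1 p.2.2 with _ | x
      · simp
      · simp [h.entry_lt _ _ _ _ e]
    rw [Finset.sum_congr rfl fun p _ => split p, Finset.sum_comm]
    refine Finset.sum_congr rfl fun k hk => ?_
    obtain ⟨p, hp, hu⟩ := h.existsUnique_cell k (Finset.mem_range.1 hk)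
    rw [Finset.sum_eq_single p, if_pos hp]
    · exact fun q _ hq => if_neg fun e => hq (hu q e)
    · simp
  have rows : ∑ p : Fin t × Fin m × Fin m, (T p.1 p.2.1 p.2.2).getD 0 = t * (m * C) := by
    simp only [Fintype.sum_prod_type]
    change ∑ l, ∑ i, (T l).rowSum i = _
    simp [hC]
  have gauss := Finset.sum_range_id_mul_two (m * s * t)
  rw [← total, rows] at gauss
  refine Nat.eq_of_mul_eq_mul_left (Nat.mul_pos ht hm) ?_
  calc t * m * (2 * C) = t * (m * C) * 2 := by ring
    _ = t * m * (s * (m * s * t - 1)) := by rw [gauss]; ring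

theorem even_or_odd (h : IsNMSS m s t T) (hm : 0 < m) (hs : 0 < s) (ht : 0 < t) :
    Even s ∨ Odd (m * t) := by
  obtain ⟨C, hC⟩ := h.sums_eq
  have e := h.two_mul_sum_eq hm ht fun l i => (hC l).1 i
  refine (Nat.even_or_odd s).imp_right fun hs' => ?_
  have hpos : 1 ≤ m * s * t := Nat.mul_pos (Nat.mul_pos hm hs) ht
  have h1 : Even (m * s * t - 1) := by
    have := e ▸ even_two_mul C
    exact (Nat.even_mul.1 this).resolve_left (Nat.not_even_iff_odd.2 hs')
  have h2 : Odd (m * s * t) := by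
    have := h1.add_one
    rwa [Nat.sub_add_cancel hpos] at this
  rw [Nat.odd_mul, Nat.odd_mul] at h2
  exact Nat.odd_mul.2 ⟨h2.1.1, h2.2⟩

/-- A lone entry is its row sum, so `0` and `1` cannot both occur. -/
theorem eq_one_of_eq_one (h : IsNMSS m 1 t T) (hm : 0 < m) (ht : 0 < t) : m = 1 ∧ t = 1 := by
  obtain ⟨C, hC⟩ := h.sums_eq
  have entry {l : Fin t} {i j : Fin m} {k : ℕ} (e : T l i j = some k) : k = C := by
    rw [← (hC l).1 i, PartialSquare.rowSum, Finset.sum_eq_single j, e, Option.getD_some]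
    · intro j' _ hj'
      obtain ⟨x, hx⟩ := Finset.card_eq_one.1 ((h.isNMS l).row_filled i)
      rcases e' : T l i j' with _ | k'
      · rfl
      · have h1 : j ∈ ({x} : Finset (Fin m)) := hx ▸ by simp [e]
        have h2 : j' ∈ ({x} : Finset (Fin m)) := hx ▸ by simp [e']
        exact absurd ((Finset.mem_singleton.1 h2).trans (Finset.mem_singleton.1 h1).symm) hj'
    · simp
  have hmt : m * t ≤ 1 := by
    by_contra! hlt
    obtain ⟨p, hp, -⟩ := h.existsUnique_cell 0 (by simp [hm, ht])
    obtain ⟨q, hq, -⟩ := h.existsUnique_cell 1 (by simpa using hlt)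
    exact zero_ne_one ((entry hp).trans (entry hq).symm)
  have := Nat.le_mul_of_pos_right m ht
  have := Nat.le_mul_of_pos_left t hm
  omega

theorem ne_two (h : IsNMSS m 2 t T) (hm : 0 < m) (ht : 0 < t) : False := by
  obtain ⟨C, hC⟩ := h.sums_eq
  -- Stated for an arbitrary line `A`, so that it serves both the row and the column of `0`.
  have partner (A : Fin m → Option ℕ) (j : Fin m) (hj : A j = some 0)
      (hcard : (Finset.univ.filter fun x => (A x).isSome).card = 2)
      (hsum : ∑ x, (A x).getD 0 = C) : ∃ x, x ≠ j ∧ A x = some C := by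
    obtain ⟨x, hx, hxj⟩ := Finset.exists_mem_ne (by omega : 1 <
      (Finset.univ.filter fun x => (A x).isSome).card) j
    refine ⟨x, hxj, ?_⟩
    have hx : (A x).isSome := by simpa using hx
    obtain ⟨k, hk⟩ := Option.isSome_iff_exists.1 hx
    have hpair : (Finset.univ.filter fun x => (A x).isSome) = {x, j} := by
      refine (Finset.eq_of_subset_of_card_le (fun y hy => ?_) ?_).symm
      · rcases Finset.mem_insert.1 hy with rfl | hy
        · simpa using hx
        · simp [Finset.mem_singleton.1 hy, hj]
      · rw [hcard, Finset.card_pair hxj]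
    rw [hk, ← hsum, Finset.sum_eq_single x, hk, Option.getD_some]
    · intro y _ hy
      rcases e : A y with _ | k'
      · rfl
      · have : y ∈ ({x, j} : Finset (Fin m)) := hpair ▸ by simp [e]
        obtain rfl : y = j := by simpa [hy] using this
        simpa [hj] using e.symm
    · simp
  obtain ⟨⟨l, i, j⟩, h0, -⟩ := h.existsUnique_cell 0 (by positivity)
  obtain ⟨j', hj', e⟩ := partner (T l i) j h0 ((h.isNMS l).row_filled i) ((hC l).1 i)
  obtain ⟨i', hi', e'⟩ := partner (fun i => T l i j) i h0 ((h.isNMS l).col_filled j) ((hC l).2 j)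
  exact hi' (h.cell_unique e' e).2.1

theorem necessary (h : IsNMSS m s t T) (hm : 0 < m) (hs : 0 < s) (ht : 0 < t) :
    (m = 1 ∧ s = 1 ∧ t = 1) ∨ (3 ≤ s ∧ s ≤ m ∧ (Even s ∨ Odd (m * t))) := by
  rcases lt_or_ge s 3 with h3 | h3
  · interval_cases s
    · obtain ⟨rfl, rfl⟩ := h.eq_one_of_eq_one hm ht
      exact Or.inl ⟨rfl, rfl, rfl⟩
    · exact (h.ne_two hm ht).elim
  · exact Or.inr ⟨h3, h.le hm ht, h.even_or_odd hm hs ht⟩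

end IsNMSS

theorem mainTheorem2 (m s t : ℕ) (hm : 0 < m) (hs : 0 < s) (ht : 0 < t) :
    ((∃ T : Fin t → PartialSquare m, IsNMSS m s t T) ↔
      (m = 1 ∧ s = 1 ∧ t = 1) ∨ (3 ≤ s ∧ s ≤ m ∧ (Even s ∨ Odd (m * t)))) ∧
    ((m = 1 ∧ s = 1 ∧ t = 1) ∨ (3 ≤ s ∧ s ≤ m ∧ (Even s ∨ Odd (m * t))) →
      ∃ T : Fin t → PartialSquare m, IsNMSS m s t T ∧
        ∀ l, (T l).OnConsecutiveDiagonals s) := by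
  have sufficient : (m = 1 ∧ s = 1 ∧ t = 1) ∨ (3 ≤ s ∧ s ≤ m ∧ (Even s ∨ Odd (m * t))) →
      ∃ T : Fin t → PartialSquare m, IsNMSS m s t T ∧
        ∀ l, (T l).OnConsecutiveDiagonals s := by
    rintro (⟨rfl, rfl, rfl⟩ | ⟨h3, hsm, h⟩)
    · exact DiagonalMagic.exists_isNMSS_one
    · exact DiagonalMagic.exists_isNMSS h3 hsm h
  exact ⟨⟨fun ⟨_, hT⟩ => hT.necessary hm hs ht,
    fun h => (sufficient h).imp fun _ hT => hT.1⟩, sufficient⟩
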